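/- Let $n\ge 2$, let $d\in\mathbb R^n$ have strictly positive entries, and let $y\in\mathbb R^n$ be arbitrary. Call a matrix $A\in\mathbb R^{n\times n}$ Gibbs-stochastic (with respect to $d$) if all entries of $A$ are non-negative, every column of $A$ sums to one, and $Ad=d$, and let $$M_d(y):=\{Ay : A\in\mathbb R^{n\times n}\text{ Gibbs-stochastic}\}$$ be the thermomajorization polytope of $y$. Then the following statements are equivalent. (i) $M_d(y)$ is not singular, that is, $M_d(y)\setminus\{y\}\neq\emptyset$. (ii) $M_d(y)$ is a convex polytope (the convex hull of finitely many points) of dimension $n-1$, where the dimension is that of its affine hull. -/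

import Mathlib

/-- The set `s_d(n)` of Gibbs-stochastic (`d`-stochastic) matrices: entrywise nonnegative real
`n × n` matrices whose columns each sum to one and which fix the vector `d`. -/
def gibbsStochastic {n : ℕ} (d : Fin n → ℝ) : Set (Matrix (Fin n) (Fin n) ℝ) :=
  {A | A ∈ Matrix.colStochastic ℝ (Fin n) ∧ A.mulVec d = d}

/-- The thermomajorization polytope `M_d(y) = {A y : A Gibbs-stochastic}`. -/
def thermoPolytope {n : ℕ} (d y : Fin n → ℝ) : Set (Fin n → ℝ) :=
  {x | ∃ A ∈ gibbsStochastic d, A.mulVec y = x}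

/-- A convex polytope: a set which is the convex hull of finitely many points. -/
def IsConvexPolytope {E : Type*} [AddCommGroup E] [Module ℝ E] (P : Set E) : Prop :=
  ∃ F : Finset E, P = convexHull ℝ (F : Set E)

/-- The dimension of a (nonempty) subset of a real vector space: the dimension of its affine
hull, i.e. of the direction of the affine span. -/
noncomputable def affineDimension {E : Type*} [AddCommGroup E] [Module ℝ E] (P : Set E) : ℕ :=
  Module.finrank ℝ (affineSpan ℝ P).direction

/-!
`M_d(y)` is the image, under the linear map `A ↦ A y`, of the set of Gibbs-stochastic matrices.
That set is compact and consists of the nonnegative solutions of a linear system, and an extreme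
point of such a set is determined by its zero pattern; so there are finitely many extreme points,
and the Krein–Milman theorem shows that the set is their convex hull
(`isConvexPolytope_nonneg_inter_fiber`). Linear images of polytopes are polytopes.

For the dimension, columns summing to one force every difference of two points of `M_d(y)` into the
hyperplane of vectors with coordinate sum zero. Conversely, if `d i * y j ≠ d j * y i`, a
Gibbs-stochastic matrix mixing only the levels `i` and `j` moves `y` by a nonzero multiple of
`e_i - e_j`. If `M_d(y) ≠ {y}`, then `y` is not a multiple of `d`, so such a pair `i, j` exists;
every other index `k` then forms such a pair with `i` or with `j`, and all the vectors `e_k - e_i`,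
which span the hyperplane, lie in the direction of the affine hull.
-/

/-! ### Compact sets of nonnegative solutions of linear systems -/

/-- An extreme point of the set of nonnegative solutions is determined by its zeros: if `x'`
vanishes wherever the extreme point `x` does, then `x` can be moved slightly both towards and away
from `x'`. -/
theorem eq_of_mem_extremePoints_of_zero_imp {ι F : Type*} [Finite ι] [AddCommGroup F] [Module ℝ F]
    (L : (ι → ℝ) →ₗ[ℝ] F) (b : F) {x x' : ι → ℝ}
    (hx : x ∈ Set.extremePoints ℝ {x : ι → ℝ | 0 ≤ x ∧ L x = b})
    (hx' : 0 ≤ x' ∧ L x' = b) (h : ∀ i, x i = 0 → x' i = 0) : x' = x := by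
  cases nonempty_fintype ι
  have hx0 : 0 ≤ x := hx.1.1
  obtain ⟨ε, hε, hle⟩ : ∃ ε : ℝ, 0 < ε ∧ ∀ i, ε * x' i ≤ x i := by
    have key : ∀ i, ∃ ε : ℝ, 0 < ε ∧ ε * x' i ≤ x i := fun i ↦ by
      rcases (hx0 i).eq_or_lt with hi | hi
      · exact ⟨1, one_pos, by simp [h i hi.symm, ← hi]⟩
      · simp only [Pi.zero_apply] at hi
        have h1 : 0 < x' i + 1 := add_pos_of_nonneg_of_pos (hx'.1 i) one_pos
        refine ⟨x i / (x' i + 1), div_pos hi h1, ?_⟩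
        rw [div_mul_eq_mul_div, div_le_iff₀ h1]
        nlinarith
    choose e he hle using key
    have hev : ∀ᶠ ε : ℝ in nhdsWithin 0 (Set.Ioi 0), 0 < ε ∧ ∀ i, ε < e i :=
      Filter.Eventually.and self_mem_nhdsWithin <| Filter.eventually_all.2 fun i ↦
        mem_nhdsWithin_of_mem_nhds (Iio_mem_nhds (he i))
    obtain ⟨ε, hε, hεe⟩ := hev.exists
    exact ⟨ε, hε, fun i ↦ (mul_le_mul_of_nonneg_right (hεe i).le (hx'.1 i)).trans (hle i)⟩
  -- `x` lies strictly between `x'` and its reflected point `(1 + ε) x - ε x'`.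
  have hz : (1 + ε) • x - ε • x' ∈ {x : ι → ℝ | 0 ≤ x ∧ L x = b} := by
    refine ⟨fun i ↦ ?_, ?_⟩
    · have h1 := hle i
      have h2 := mul_nonneg hε.le (hx0 i)
      simp only [Pi.zero_apply, Pi.sub_apply, Pi.smul_apply, smul_eq_mul]
      linarith
    · rw [map_sub, map_smul, map_smul, hx.1.2, hx'.2]
      module
  refine hx.2 hx' hz ⟨ε / (1 + ε), 1 / (1 + ε), by positivity, by positivity, by field_simp; ring, ?_⟩
  ext i
  simp only [Pi.add_apply, Pi.sub_apply, Pi.smul_apply, smul_eq_mul]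
  field_simp
  ring

/-- A compact set of nonnegative solutions has at most one extreme point for each zero pattern,
hence finitely many, and is their convex hull by the Krein–Milman theorem. -/
theorem isConvexPolytope_nonneg_inter_fiber {ι F : Type*} [Finite ι] [AddCommGroup F] [Module ℝ F]
    (L : (ι → ℝ) →ₗ[ℝ] F) (b : F) (hc : IsCompact {x : ι → ℝ | 0 ≤ x ∧ L x = b}) :
    IsConvexPolytope {x : ι → ℝ | 0 ≤ x ∧ L x = b} := by
  set P := {x : ι → ℝ | 0 ≤ x ∧ L x = b} with hP
  have hconv : Convex ℝ P :=
    (convex_Ici (𝕜 := ℝ) (0 : ι → ℝ)).inter ((convex_singleton b).linear_preimage L)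
  have hfin : (P.extremePoints ℝ).Finite := by
    refine Set.Finite.of_finite_image (f := fun x : ι → ℝ ↦ {i | x i = 0}) (Set.toFinite _) ?_
    intro x hx x' hx' hxx'
    exact (eq_of_mem_extremePoints_of_zero_imp L b hx hx'.1 fun i hi ↦
      (Set.ext_iff.1 hxx' i).1 hi).symm
  refine ⟨hfin.toFinset, ?_⟩
  rw [hfin.coe_toFinset, ← (hfin.isClosed_convexHull ℝ).closure_eq]
  exact (closure_convexHull_extremePoints hc hconv).symm

theorem IsConvexPolytope.image {E F : Type*} [AddCommGroup E] [Module ℝ E] [AddCommGroup F]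
    [Module ℝ F] {P : Set E} (hP : IsConvexPolytope P) (f : E →ₗ[ℝ] F) :
    IsConvexPolytope (f '' P) := by
  classical
  obtain ⟨s, rfl⟩ := hP
  exact ⟨s.image f, by rw [f.image_convexHull, Finset.coe_image]⟩

/-! ### Gibbs-stochastic matrices -/

theorem mem_gibbsStochastic_iff {n : ℕ} {d : Fin n → ℝ} {A : Matrix (Fin n) (Fin n) ℝ} :
    A ∈ gibbsStochastic d ↔
      (∀ i j, 0 ≤ A i j) ∧ (∀ j, ∑ i, A i j = 1) ∧ ∀ i, ∑ j, A i j * d j = d i := by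
  rw [gibbsStochastic, Set.mem_ofPred_eq, Matrix.mem_colStochastic_iff_sum, and_assoc, funext_iff]
  rfl

theorem isConvexPolytope_thermoPolytope {n : ℕ} (d y : Fin n → ℝ) :
    IsConvexPolytope (thermoPolytope d y) := by
  -- Matrices are indexed by pairs; `L` collects the column sums and the product with `d`.
  let L : (Fin n × Fin n → ℝ) →ₗ[ℝ] (Fin n → ℝ) × (Fin n → ℝ) :=
    { toFun := fun x ↦ (fun j ↦ ∑ i, x (i, j), fun i ↦ ∑ j, x (i, j) * d j)
      map_add' := fun x x' ↦ by
        ext <;> simp [add_mul, Finset.sum_add_distrib]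
      map_smul' := fun c x ↦ by
        ext <;> simp [Finset.mul_sum, mul_assoc] }
  let f : (Fin n × Fin n → ℝ) →ₗ[ℝ] (Fin n → ℝ) :=
    { toFun := fun x i ↦ ∑ j, x (i, j) * y j
      map_add' := fun x x' ↦ by
        ext; simp [add_mul, Finset.sum_add_distrib]
      map_smul' := fun c x ↦ by
        ext; simp [Finset.mul_sum, mul_assoc] }
  have hmem : ∀ x : Fin n × Fin n → ℝ, (0 ≤ x ∧ L x = (1, d)) ↔
      Matrix.of (fun i j ↦ x (i, j)) ∈ gibbsStochastic d := fun x ↦ by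
    simp only [mem_gibbsStochastic_iff, Pi.le_def, Prod.forall, Prod.ext_iff, funext_iff]
    rfl
  have himage : thermoPolytope d y = f '' {x | 0 ≤ x ∧ L x = (1, d)} := by
    ext v
    constructor
    · rintro ⟨A, hA, rfl⟩
      exact ⟨fun p ↦ A p.1 p.2, (hmem _).2 hA, rfl⟩
    · rintro ⟨x, hx, rfl⟩
      exact ⟨_, (hmem x).1 hx, rfl⟩
  rw [himage]
  refine (isConvexPolytope_nonneg_inter_fiber L (1, d) ?_).image f
  refine (isCompact_Icc (a := (0 : Fin n × Fin n → ℝ)) (b := 1)).of_isClosed_subset ?_ ?_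
  · exact isClosed_Ici.inter (isClosed_singleton.preimage L.continuous_of_finiteDimensional)
  · rintro x hx
    refine ⟨hx.1, fun p ↦ ?_⟩
    have h := (mem_gibbsStochastic_iff.1 ((hmem x).1 hx)).2.1 p.2
    calc x p ≤ ∑ i, x (i, p.2) :=
          Finset.single_le_sum (f := fun i ↦ x (i, p.2)) (fun i _ ↦ hx.1 (i, p.2))
            (Finset.mem_univ p.1)
      _ = 1 := h

theorem self_mem_thermoPolytope {n : ℕ} (d y : Fin n → ℝ) : y ∈ thermoPolytope d y :=
  ⟨1, ⟨one_mem _, Matrix.one_mulVec d⟩, Matrix.one_mulVec y⟩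

theorem sum_eq_of_mem_thermoPolytope {n : ℕ} {d y x : Fin n → ℝ} (hx : x ∈ thermoPolytope d y) :
    ∑ i, x i = ∑ i, y i := by
  obtain ⟨A, hA, rfl⟩ := hx
  exact Matrix.sum_mulVec_of_mem_colStochastic hA.1

/-- The matrix `1 + t (e_i - e_j) (d_i e_j - d_j e_i)ᵀ`, with `t > 0` small, is Gibbs-stochastic;
this is its action on `y`. -/
theorem exists_add_smul_single_sub_single_mem {n : ℕ} (d y : Fin n → ℝ) (hd : ∀ i, 0 < d i)
    (i j : Fin n) :
    ∃ t : ℝ, 0 < t ∧ y + (t * (d i * y j - d j * y i)) • (Pi.single i 1 - Pi.single j 1) ∈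
      thermoPolytope d y := by
  have hi := hd i
  have hj := hd j
  -- Then `t * d i ≤ 1` and `t * d j ≤ 1`, so the diagonal entries stay nonnegative.
  obtain ⟨t, htpos, ht1⟩ : ∃ t : ℝ, 0 < t ∧ t * d i + t * d j = 1 :=
    ⟨1 / (d i + d j), by positivity, by field_simp⟩
  refine ⟨t, htpos, ?_⟩
  have hti : 0 < t * d i := by positivity
  have htj : 0 < t * d j := by positivity
  let u : Fin n → ℝ := Pi.single i 1 - Pi.single j 1
  let w : Fin n → ℝ := Pi.single j (d i) - Pi.single i (d j)
  have hmul : ∀ v : Fin n → ℝ, (1 + t • Matrix.vecMulVec u w).mulVec v =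
      v + (t * (d i * v j - d j * v i)) • u := fun v ↦ by
    have hw : w ⬝ᵥ v = d i * v j - d j * v i := by simp [w, sub_dotProduct]
    rw [Matrix.add_mulVec, Matrix.one_mulVec, Matrix.smul_mulVec, Matrix.vecMulVec_mulVec, hw]
    ext k
    simp
    ring
  refine ⟨1 + t • Matrix.vecMulVec u w, mem_gibbsStochastic_iff.2 ⟨?_, ?_, ?_⟩, hmul y⟩
  · intro k l
    simp only [Matrix.add_apply, Matrix.smul_apply, Matrix.vecMulVec_apply, Matrix.one_apply,
      Pi.sub_apply, Pi.single_apply, smul_eq_mul, u, w]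
    split_ifs <;> first | linarith | grind
  · intro l
    have hu : ∑ k, u k = 0 := by simp [u]
    simp [Finset.sum_add_distrib, Matrix.vecMulVec_apply, Matrix.one_apply, ← Finset.mul_sum,
      ← Finset.sum_mul, hu]
  · intro k
    have := congrFun (hmul d) k
    rw [mul_comm (d j), sub_self] at this
    simpa [Matrix.mulVec, dotProduct] using this

theorem single_sub_single_mem_vectorSpan {n : ℕ} {d y : Fin n → ℝ} (hd : ∀ i, 0 < d i)
    {i j : Fin n} (hij : d i * y j ≠ d j * y i) :
    (Pi.single i 1 - Pi.single j 1 : Fin n → ℝ) ∈ vectorSpan ℝ (thermoPolytope d y) := by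
  obtain ⟨t, ht, hmem⟩ := exists_add_smul_single_sub_single_mem d y hd i j
  have h := vsub_mem_vectorSpan ℝ hmem (self_mem_thermoPolytope d y)
  rw [vsub_eq_sub, add_sub_cancel_left] at h
  exact ((vectorSpan ℝ (thermoPolytope d y)).smul_mem_iff
    (mul_ne_zero ht.ne' (sub_ne_zero.2 hij))).1 h

/-! ### The dimension of the thermomajorization polytope -/

theorem exists_mul_ne_mul_of_thermoPolytope_nontrivial {n : ℕ} {d y : Fin n → ℝ}
    (hd : ∀ i, 0 < d i) (h : (thermoPolytope d y \ {y}).Nonempty) :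
    ∃ i j, d i * y j ≠ d j * y i := by
  by_contra! hall
  obtain ⟨x, ⟨A, hA, rfl⟩, hx⟩ := h
  refine hx (funext fun k ↦ ?_)
  -- All the products agree, so `d k • y = y k • d`, and `A` fixes `d`.
  have hk : d k • y = y k • d := by
    ext l
    simpa [mul_comm] using hall k l
  have h1 : d k • A.mulVec y = d k • y := by
    rw [← Matrix.mulVec_smul, hk, Matrix.mulVec_smul, hA.2]
  simpa [(hd k).ne'] using congrFun h1 k

theorem vectorSpan_thermoPolytope {n : ℕ} {d y : Fin n → ℝ} (hd : ∀ i, 0 < d i)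
    (h : (thermoPolytope d y \ {y}).Nonempty) :
    vectorSpan ℝ (thermoPolytope d y) =
      LinearMap.ker (∑ i, LinearMap.proj (R := ℝ) (φ := fun _ : Fin n ↦ ℝ) i) := by
  apply le_antisymm
  · rw [vectorSpan_def, Submodule.span_le]
    rintro _ ⟨x, hx, x', hx', rfl⟩
    simp [sum_eq_of_mem_thermoPolytope hx, sum_eq_of_mem_thermoPolytope hx']
  · obtain ⟨i, j, hij⟩ := exists_mul_ne_mul_of_thermoPolytope_nontrivial hd h
    have hmem : ∀ k, (Pi.single k 1 - Pi.single i 1 : Fin n → ℝ) ∈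
        vectorSpan ℝ (thermoPolytope d y) := fun k ↦ by
      -- `k` cannot have the same ratio `y / d` as both `i` and `j`; if it agrees with `i`, use `j`.
      by_cases hki : d k * y i = d i * y k
      · have hkj : d k * y j ≠ d j * y k := fun hkj ↦ hij <| by
          apply mul_left_cancel₀ (hd k).ne'
          linear_combination d i * hkj - d j * hki
        have h2 := Submodule.sub_mem _ (single_sub_single_mem_vectorSpan hd hkj)
          (single_sub_single_mem_vectorSpan hd hij)
        rwa [sub_sub_sub_cancel_right] at h2
      · exact single_sub_single_mem_vectorSpan hd hki
    intro v hv
    have hv0 : ∑ k, v k = 0 := by simpa using hv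
    have hsum : v = ∑ k, v k • (Pi.single k 1 - Pi.single i 1 : Fin n → ℝ) := by
      simp_rw [smul_sub, Finset.sum_sub_distrib, ← Finset.sum_smul, hv0, zero_smul, sub_zero]
      exact pi_eq_sum_univ' v
    rw [hsum]
    exact Submodule.sum_mem _ fun k _ ↦ Submodule.smul_mem _ _ (hmem k)

theorem finrank_ker_sum_proj (n : ℕ) :
    Module.finrank ℝ (LinearMap.ker
      (∑ i, LinearMap.proj (R := ℝ) (φ := fun _ : Fin n ↦ ℝ) i)) = n - 1 := by
  rcases n with _ | n
  · exact Module.finrank_zero_of_subsingleton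
  · have hne : (∑ i, LinearMap.proj (R := ℝ) (φ := fun _ : Fin (n + 1) ↦ ℝ) i) ≠ 0 := fun h ↦ by
      simpa using LinearMap.congr_fun h (Pi.single 0 1)
    have h := Module.Dual.finrank_ker_add_one_of_ne_zero hne
    rw [Module.finrank_fin_fun] at h
    omega

theorem mainTheorem5 (n : ℕ) (hn : 2 ≤ n) (d y : Fin n → ℝ) (hd : ∀ i, 0 < d i) :
    (thermoPolytope d y \ {y}).Nonempty ↔
      (IsConvexPolytope (thermoPolytope d y) ∧ affineDimension (thermoPolytope d y) = n - 1) := by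
  refine ⟨fun h ↦ ⟨isConvexPolytope_thermoPolytope d y, ?_⟩, fun ⟨_, hdim⟩ ↦ ?_⟩
  · rw [affineDimension, direction_affineSpan, vectorSpan_thermoPolytope hd h, finrank_ker_sum_proj]
  · by_contra hempty
    have hsub : thermoPolytope d y ⊆ {y} := by
      rwa [Set.not_nonempty_iff_eq_empty, Set.sdiff_eq_empty] at hempty
    rw [hsub.antisymm (Set.singleton_subset_iff.2 (self_mem_thermoPolytope d y)), affineDimension,
      direction_affineSpan, vectorSpan_singleton, finrank_bot] at hdim
    omega
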